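/- Let $S$ be a finite set with at least three elements, $\Omega=S^{\infty}$ with its product $\sigma$-algebra $\mathcal G$, and let $X$ be the set of Borel probability measures on a compact metrizable space $C$ with at least two points, with the weak topology. For a measurable space $(Y,\mathcal A)$ let $\Delta(Y)$ be the set of finitely additive probabilities on $\mathcal A$, with the weak topology generated by the maps $p\mapsto\int\xi\,dp$ for bounded measurable $\xi$, and its Borel $\sigma$-algebra. For a countably additive probability $\mu$ on $\Delta(Y)$ and a continuous strictly increasing $\phi:\mathbb R\to\mathbb R$ put $$I^{\phi}_{\mu}(\xi)=\phi^{-1}\Big(\int_{\Delta(Y)}\phi\Big(\int_Y\xi\,dp\Big)d\mu(p)\Big),\qquad \xi:Y\to\mathbb R\text{ bounded and measurable}.$$ For $P\in\Delta(Y)$ let $\Gamma(P,\mu)$ be the set of countably additive probabilities $\nu\ll\mu$ on $\Delta(Y)$ with $P(A)=\int Q(A)\,d\nu(Q)$ for all $A\in\mathcal A$, let $R(\nu\|\mu)=\int\log\frac{d\nu}{d\mu}\,d\nu\in[0,\infty]$ be relative entropy, and let $\kappa_\mu(P)=\min_{\nu\in\Gamma(P,\mu)}R(\nu\|\mu)$,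 with $\kappa_\mu(P)=\infty$ if $\Gamma(P,\mu)=\emptyset$. Let $\beta\in(0,1)$, $\theta>0$, let $u:X\to\mathbb R$ be affine, continuous and non-constant, $U(\mathbf D)=\{\sum_{t\ge0}\beta^tu(d_t):d\in X^{\infty}\}$, let $\mu_0$ and $\mu_{+1}$ be countably additive probabilities on $\Delta(\Omega)$ and $\Delta(S)$, and let $\phi_0(x)=-\exp(-\theta x)$ and $\phi_1(x)=-\exp(-\theta\beta x)$. Suppose that for every $P\in\Delta(\Omega)$ $$\kappa_{\mu_0}(P)=\sum_{s\in S}P_{+1}(s)\,\kappa_{\mu_0}(P_s)+\kappa_{\mu_{+1}}(P_{+1}),$$ where $P_{+1}$ is the marginal of $P$ on the first coordinate, $P_s$ is the conditional law under $P$ of $(s_2,s_3,\dots)$ given $s_1=s$, and terms with $P_{+1}(s)=0$ are zero. Then generalized rectangularity holds: for every bounded $\mathcal G$-measurable $\xi:\Omega\to U(\mathbf D)$, $$I^{\phi_0}_{\mu_0}(\xi)=\beta\, I^{\phi_1}_{\mu_{+1}}\Big(s\mapsto\tfrac1\beta I^{\phi_0}_{\mu_0}(\xi^{s,1})\Big),\qquad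 \xi^{s,1}(\omega_1,\omega_2,\dots)=\xi(s,\omega_1,\omega_2,\dots).$$ -/

import Mathlib

open MeasureTheory

namespace GenRect

noncomputable section

/-- `B(K, Y, 𝒜)`: bounded measurable real functions on `Y` with values in `K`. -/
def BddMeas (K : Set ℝ) (Y : Type*) [MeasurableSpace Y] : Set (Y → ℝ) :=
  {ξ | Measurable ξ ∧ (∃ M : ℝ, ∀ y, |ξ y| ≤ M) ∧ ∀ y, ξ y ∈ K}

/-- `Δ(Y)`: finitely additive probability measures on the measurable sets of `Y`.
The value on non-measurable sets is fixed to be `0`, so that two of them are equal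
as soon as they agree on all measurable sets. -/
@[ext]
structure FinAddProb (Y : Type*) [MeasurableSpace Y] where
  /-- the probability of an event -/
  prob : Set Y → ℝ
  nonneg : ∀ A, MeasurableSet A → 0 ≤ prob A
  univ : prob Set.univ = 1
  union : ∀ A B, MeasurableSet A → MeasurableSet B → Disjoint A B →
    prob (A ∪ B) = prob A + prob B
  not_meas : ∀ A, ¬ MeasurableSet A → prob A = 0

namespace FinAddProb

variable {Y Z : Type*} [MeasurableSpace Y] [MeasurableSpace Z]

/-- `∫ ξ dp` for a bounded measurable `ξ` and a finitely additive probability `p`: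
the supremum of the integrals of the simple measurable functions below `ξ`. -/
def integral (p : FinAddProb Y) (ξ : Y → ℝ) : ℝ :=
  sSup {r | ∃ f : SimpleFunc Y ℝ, (∀ y, f y ≤ ξ y) ∧
    r = ∑ x ∈ f.range, x * p.prob (f ⁻¹' {x})}

/-- The topology of weak convergence on `Δ(Y)`: the coarsest one for which `p ↦ ∫ ξ dp` is
continuous for each bounded measurable `ξ`. -/
instance : TopologicalSpace (FinAddProb Y) :=
  TopologicalSpace.induced
    (fun (p : FinAddProb Y) (ξ : BddMeas Set.univ Y) => p.integral ξ.1) inferInstance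

/-- `Δ(Y)` carries the Borel `σ`-algebra of the topology of weak convergence. -/
instance : MeasurableSpace (FinAddProb Y) := borel _

instance : BorelSpace (FinAddProb Y) := ⟨rfl⟩

open Classical in
/-- The image of a finitely additive probability under a measurable map. -/
def map (p : FinAddProb Y) (f : Y → Z) (hf : Measurable f) : FinAddProb Z where
  prob B := if MeasurableSet B then p.prob (f ⁻¹' B) else 0
  nonneg B hB := by
    rw [if_pos hB]
    exact p.nonneg _ (hf hB)
  univ := by simp [p.univ]
  union A B hA hB hd := by
    rw [if_pos hA, if_pos hB, if_pos (hA.union hB), Set.preimage_union]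
    exact p.union _ _ (hf hA) (hf hB) (hd.preimage f)
  not_meas B hB := if_neg hB

variable {S : Type*} [MeasurableSpace S]

/-- `P₊₁`: the marginal of `P ∈ Δ(S^∞)` on the first coordinate. -/
def marginal (P : FinAddProb (ℕ → S)) : FinAddProb S :=
  P.map (fun ω => ω 0) (measurable_pi_apply 0)

theorem measurable_shift : Measurable (fun (ω : ℕ → S) (n : ℕ) => ω (n + 1)) :=
  measurable_pi_lambda _ fun n => measurable_pi_apply (n + 1)

theorem measurableSet_head [MeasurableSingletonClass S] (s : S) :
    MeasurableSet {ω : ℕ → S | ω 0 = s} :=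
  (measurable_pi_apply (X := fun _ : ℕ => S) 0) (measurableSet_singleton s)

open Classical in
/-- `P_s`: the conditional law, under `P ∈ Δ(S^∞)`, of the continuation `(s₂, s₃, …)` given
`s₁ = s`. When `P(s₁ = s) = 0` it is not defined and we put `P` itself as a placeholder; it is
only ever used multiplied by `P(s₁ = s)`. -/
def conditional [MeasurableSingletonClass S] (P : FinAddProb (ℕ → S)) (s : S) :
    FinAddProb (ℕ → S) :=
  if h : P.prob {ω | ω 0 = s} = 0 then P else
  { prob := fun A => if MeasurableSet A then
        P.prob ({ω | ω 0 = s} ∩ (fun ω n => ω (n + 1)) ⁻¹' A) / P.prob {ω | ω 0 = s}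
      else 0
    nonneg := fun A hA => by
      have hs := measurableSet_head s
      rw [if_pos hA]
      exact div_nonneg (P.nonneg _ (hs.inter (measurable_shift hA))) (P.nonneg _ hs)
    univ := by simp [h]
    union := fun A B hA hB hd => by
      have hs := measurableSet_head s
      rw [if_pos hA, if_pos hB, if_pos (hA.union hB), Set.preimage_union,
        Set.inter_union_distrib_left,
        P.union _ _ (hs.inter (measurable_shift hA)) (hs.inter (measurable_shift hB))
          ((hd.preimage _).mono Set.inter_subset_right Set.inter_subset_right), add_div]
    not_meas := fun A hA => if_neg hA }

end FinAddProb

/-- `Γ(P, μ)`: the countably additive probabilities `ν ≪ μ` on `Δ(Y)` with barycenter `P`,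
that is, `P(A) = ∫ Q(A) dν(Q)` for all events `A`. -/
def Gamma {Y : Type*} [MeasurableSpace Y] (P : FinAddProb Y) (μ : Measure (FinAddProb Y)) :
    Set (Measure (FinAddProb Y)) :=
  {ν | IsProbabilityMeasure ν ∧ ν ≪ μ ∧
    ∀ A, MeasurableSet A → P.prob A = ∫ Q, Q.prob A ∂ν}

/-- `min {R(ν ‖ μ) : ν ∈ Γ(P, μ)}` in `[0, ∞]`, equal to `∞` if `Γ(P, μ)` is empty. -/
def minEntropy {Y : Type*} [MeasurableSpace Y] (μ : Measure (FinAddProb Y))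
    (P : FinAddProb Y) : ENNReal :=
  ⨅ ν ∈ Gamma P μ, InformationTheory.klDiv ν μ

/-- The smooth ambiguity functional `I^φ_μ(ξ) = φ⁻¹(∫ φ(∫ ξ dp) dμ(p))`. -/
def smoothCE {Y : Type*} [MeasurableSpace Y] (φ : ℝ → ℝ) (μ : Measure (FinAddProb Y))
    (ξ : Y → ℝ) : ℝ :=
  Function.invFun φ (∫ p, φ (p.integral ξ) ∂μ)

/-- The history `(s, ω₁, ω₂, …)`. -/
def prepend {S : Type*} (s : S) (ω : ℕ → S) : ℕ → S
  | 0 => s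
  | n + 1 => ω n

/-- The continuation `ξ^{s,1}(ω) = ξ(s, ω)`. -/
def continuation {S : Type*} (ξ : (ℕ → S) → ℝ) (s : S) : (ℕ → S) → ℝ :=
  fun ω => ξ (prepend s ω)

/-- Generalized rectangularity of `I₀` and `I₊₁`, for the random variables with values in `K`. -/
def GeneralizedRectangularity {S : Type*} [MeasurableSpace S] (K : Set ℝ) (β : ℝ)
    (I₀ : ((ℕ → S) → ℝ) → ℝ) (I₁ : (S → ℝ) → ℝ) : Prop :=
  ∀ ξ ∈ BddMeas K (ℕ → S), I₀ ξ = β * I₁ (fun s => 1 / β * I₀ (continuation ξ s))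

/-- The entropic no-gain condition (with `0 · ∞ = 0`). -/
def EntropicNoGain {S : Type*} [Fintype S] [MeasurableSpace S] [MeasurableSingletonClass S]
    (μ₀ : Measure (FinAddProb (ℕ → S))) (μ₁ : Measure (FinAddProb S)) : Prop :=
  ∀ P : FinAddProb (ℕ → S),
    minEntropy μ₀ P =
      ∑ s : S, ENNReal.ofReal (P.marginal.prob {s}) * minEntropy μ₀ (P.conditional s)
        + minEntropy μ₁ P.marginal

/-- Affinity of a utility function on the lotteries over `C`. -/
def AffineOnLotteries {C : Type*} [MeasurableSpace C] (u : ProbabilityMeasure C → ℝ) : Prop :=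
  ∀ (a : ℝ) (x y z : ProbabilityMeasure C), 0 ≤ a → a ≤ 1 →
    (z : Measure C) = ENNReal.ofReal a • (x : Measure C) + ENNReal.ofReal (1 - a) • (y : Measure C) →
    u z = a * u x + (1 - a) * u y

/-- The range `U(𝐃)` of discounted utility `U(d) = ∑_t β^t u(d_t)` over the deterministic
consumption plans `d ∈ X^∞`. -/
def discountedRange {X : Type*} (u : X → ℝ) (β : ℝ) : Set ℝ :=
  Set.range fun d : ℕ → X => ∑' t, β ^ t * u (d t)

end

end GenRect

open GenRect

/-! For exponential `φ`, `θ * I(ξ)` is `-log ∫ exp(-∫ θξ dp) dμ(p)`, the `entropicCE` of `θξ`. By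
the Gibbs variational principle this is the minimum of `∫ F dν + R(ν‖μ)` over `ν`, with `F(p) = ∫ θξ
dp`. Since `∫ F dν` depends on `ν` only through its barycenter `P`, grouping the `ν` by barycenter
gives `entropicCE μ ξ = min_P (∫ ξ dP + κ_μ(P))` (`entropicCE_le`, `exists_entropicCE_eq`).

On histories, iterated expectation and the no-gain identity split this objective into `∑ s, P₊₁(s)
(∫ ξ^{s,1} dP_s + κ(P_s)) + κ(P₊₁)`. A marginal and continuation laws can be prescribed
independently (`compose`), so the minimum can be taken over each `P_s` and then over `P₊₁`: this is
`entropicCE_recursion`. Rescaling by `θ` and `θβ` gives the theorem. -/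

namespace GenRect

/-! ### Integration of simple functions against finitely additive probabilities. -/

namespace FinAddProb

variable {Y Z : Type*} [MeasurableSpace Y] [MeasurableSpace Z]

theorem prob_empty (p : FinAddProb Y) : p.prob ∅ = 0 := by
  have h := p.union ∅ ∅ .empty .empty (by simp)
  simp only [Set.union_self] at h
  linarith

theorem prob_mono (p : FinAddProb Y) {A B : Set Y} (hA : MeasurableSet A) (hB : MeasurableSet B)
    (hAB : A ⊆ B) : p.prob A ≤ p.prob B := by
  have h := p.union A (B \ A) hA (hB.diff hA) Set.disjoint_sdiff_right
  rw [Set.union_sdiff_cancel hAB] at h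
  linarith [p.nonneg _ (hB.diff hA)]

theorem prob_le_one (p : FinAddProb Y) {A : Set Y} (hA : MeasurableSet A) : p.prob A ≤ 1 :=
  p.univ ▸ p.prob_mono hA .univ (Set.subset_univ A)

theorem prob_nonneg (p : FinAddProb Y) (A : Set Y) : 0 ≤ p.prob A := by
  by_cases hA : MeasurableSet A
  · exact p.nonneg A hA
  · rw [p.not_meas A hA]

theorem ext_of_measurableSet {p q : FinAddProb Y}
    (h : ∀ A, MeasurableSet A → p.prob A = q.prob A) : p = q := by
  ext A
  by_cases hA : MeasurableSet A
  · exact h A hA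
  · rw [p.not_meas A hA, q.not_meas A hA]

theorem prob_eq_sum_fiber (p : FinAddProb Y) {ι : Type*} [Fintype ι] (h : Y → ι)
    (hh : ∀ i, MeasurableSet (h ⁻¹' {i})) {A : Set Y} (hA : MeasurableSet A) :
    p.prob A = ∑ i, p.prob (h ⁻¹' {i} ∩ A) := by
  classical
  have hmeas (t : Finset ι) : MeasurableSet (h ⁻¹' (t : Set ι)) := by
    have : h ⁻¹' (t : Set ι) = ⋃ i ∈ t, h ⁻¹' {i} := by ext; simp
    rw [this]
    exact t.measurableSet_biUnion fun i _ => hh i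
  have key (t : Finset ι) : p.prob (h ⁻¹' (t : Set ι) ∩ A) = ∑ i ∈ t, p.prob (h ⁻¹' {i} ∩ A) := by
    induction t using Finset.induction_on with
    | empty => simp [p.prob_empty]
    | insert i t hi ih =>
      rw [Finset.sum_insert hi, ← ih, ← p.union _ _ ((hh i).inter hA) ((hmeas t).inter hA),
        ← Set.union_inter_distrib_right, ← Set.preimage_union, Finset.coe_insert,
        Set.insert_eq]
      refine Set.disjoint_left.2 ?_
      rintro y ⟨hy, -⟩ ⟨hy', -⟩
      simp only [Set.mem_preimage, Set.mem_singleton_iff, Finset.mem_coe] at hy hy'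
      exact hi (hy ▸ hy')
  simpa using key Finset.univ

/-- The integral of a simple function against a finitely additive probability. -/
noncomputable def simpleIntegral (p : FinAddProb Y) (f : SimpleFunc Y ℝ) : ℝ :=
  ∑ x ∈ f.range, x * p.prob (f ⁻¹' {x})

/-- The operator-valued set function `A ↦ p(A) • id`. -/
noncomputable def weightedId (p : FinAddProb Y) (A : Set Y) : ℝ →L[ℝ] ℝ :=
  p.prob A • ContinuousLinearMap.id ℝ ℝ

/-- With reference measure `0` every finiteness and integrability side condition is trivial, so the
calculus of `setToSimpleFunc` applies to a set function that is only finitely additive. -/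
theorem finMeasAdditive_weightedId (p : FinAddProb Y) :
    FinMeasAdditive (0 : Measure Y) p.weightedId := fun s t hs ht _ _ hd => by
  simp only [weightedId, p.union s t hs ht hd, add_smul]

theorem simpleIntegral_eq_setToSimpleFunc (p : FinAddProb Y) (f : SimpleFunc Y ℝ) :
    p.simpleIntegral f = f.setToSimpleFunc p.weightedId := by
  simp [simpleIntegral, SimpleFunc.setToSimpleFunc, weightedId, mul_comm]

theorem simpleIntegral_add (p : FinAddProb Y) (f g : SimpleFunc Y ℝ) :
    p.simpleIntegral (f + g) = p.simpleIntegral f + p.simpleIntegral g := by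
  simp only [simpleIntegral_eq_setToSimpleFunc]
  exact SimpleFunc.setToSimpleFunc_add _ p.finMeasAdditive_weightedId
    integrable_zero_measure integrable_zero_measure

theorem simpleIntegral_mono (p : FinAddProb Y) {f g : SimpleFunc Y ℝ} (h : f ≤ g) :
    p.simpleIntegral f ≤ p.simpleIntegral g := by
  simp only [simpleIntegral_eq_setToSimpleFunc]
  refine SimpleFunc.setToSimpleFunc_mono p.finMeasAdditive_weightedId (fun s hs _ x hx => ?_)
    integrable_zero_measure integrable_zero_measure h
  simpa [weightedId] using mul_nonneg (p.nonneg s hs) hx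

theorem simpleIntegral_const (p : FinAddProb Y) (c : ℝ) :
    p.simpleIntegral (SimpleFunc.const Y c) = c := by
  rw [simpleIntegral_eq_setToSimpleFunc, SimpleFunc.setToSimpleFunc_const]
  · simp [weightedId, p.univ]
  · simp [weightedId, p.prob_empty]

theorem simpleIntegral_indicator (p : FinAddProb Y) {A : Set Y} (hA : MeasurableSet A) :
    p.simpleIntegral (SimpleFunc.piecewise A hA (SimpleFunc.const Y 1) (SimpleFunc.const Y 0)) =
      p.prob A := by
  rw [simpleIntegral_eq_setToSimpleFunc, SimpleFunc.setToSimpleFunc_indicator]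
  · simp [weightedId]
  · simp [weightedId, p.prob_empty]

theorem simpleIntegral_eq_sum_of_subset (p : FinAddProb Y) (f : SimpleFunc Y ℝ) {t : Finset ℝ}
    (ht : f.range ⊆ t) : p.simpleIntegral f = ∑ x ∈ t, x * p.prob (f ⁻¹' {x}) := by
  refine Finset.sum_subset ht fun x _ hx => ?_
  rw [SimpleFunc.preimage_eq_empty_iff f x |>.2 (by simpa using hx), p.prob_empty, mul_zero]

theorem simpleIntegral_comp (p : FinAddProb Z) {g : Z → Y} (hg : Measurable g)
    (f : SimpleFunc Y ℝ) :
    p.simpleIntegral (f.comp g hg) = ∑ x ∈ f.range, x * p.prob (g ⁻¹' (f ⁻¹' {x})) :=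
  p.simpleIntegral_eq_sum_of_subset _ (SimpleFunc.range_comp_subset_range f hg)

/-- A simple function that is `ε`-close from below to `ξ` approximates the integral. -/
theorem integral_mem_Icc (p : FinAddProb Y) {ξ : Y → ℝ} {f : SimpleFunc Y ℝ} {ε : ℝ}
    (hf : ∀ y, f y ≤ ξ y) (hf' : ∀ y, ξ y ≤ f y + ε) :
    p.integral ξ ∈ Set.Icc (p.simpleIntegral f) (p.simpleIntegral f + ε) := by
  -- Every simple function below `ξ` is below `f + ε`, so the set is bounded above and `sSup` is a
  -- true supremum.
  have hub : p.simpleIntegral f + ε ∈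
      upperBounds {r | ∃ f : SimpleFunc Y ℝ, (∀ y, f y ≤ ξ y) ∧
        r = ∑ x ∈ f.range, x * p.prob (f ⁻¹' {x})} := by
    rintro _ ⟨g, hg, rfl⟩
    rw [← p.simpleIntegral_const ε, ← simpleIntegral_add]
    exact p.simpleIntegral_mono fun y => (hg y).trans (hf' y)
  exact ⟨le_csSup ⟨_, hub⟩ ⟨f, hf, rfl⟩, csSup_le ⟨_, f, hf, rfl⟩ hub⟩

theorem integral_simpleFunc (p : FinAddProb Y) (f : SimpleFunc Y ℝ) :
    p.integral f = p.simpleIntegral f := by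
  have h := p.integral_mem_Icc (ξ := f) (f := f) (ε := 0) (fun _ => le_rfl) (fun _ => by simp)
  rw [add_zero, Set.Icc_self] at h
  exact h

end FinAddProb

/-! ### Bounded measurable functions and their uniform approximation. -/

theorem BddMeas.comp {Y Z : Type*} [MeasurableSpace Y] [MeasurableSpace Z] {ξ : Y → ℝ}
    (hξ : ξ ∈ BddMeas Set.univ Y) {g : Z → Y} (hg : Measurable g) :
    ξ ∘ g ∈ BddMeas Set.univ Z :=
  ⟨hξ.1.comp hg, hξ.2.1.imp fun _ hM z => hM (g z), fun _ => trivial⟩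

theorem BddMeas.const_mul {Y : Type*} [MeasurableSpace Y] {ξ : Y → ℝ}
    (hξ : ξ ∈ BddMeas Set.univ Y) (c : ℝ) : (fun y => c * ξ y) ∈ BddMeas Set.univ Y := by
  obtain ⟨hm, ⟨M, hM⟩, -⟩ := hξ
  refine ⟨hm.const_mul c, ⟨|c| * M, fun y => ?_⟩, fun _ => trivial⟩
  rw [abs_mul]
  exact mul_le_mul_of_nonneg_left (hM y) (abs_nonneg c)

theorem mem_bddMeas_of_finite {Y : Type*} [MeasurableSpace Y] [MeasurableSingletonClass Y]
    [Finite Y] (g : Y → ℝ) : g ∈ BddMeas Set.univ Y := by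
  obtain ⟨M, hM⟩ := (Set.finite_range fun y => |g y|).bddAbove
  exact ⟨measurable_of_finite g, ⟨M, fun y => hM ⟨y, rfl⟩⟩, fun _ => trivial⟩

/-- Uniform approximation from below by simple functions. -/
theorem exists_simpleFunc_approx {Y : Type*} [MeasurableSpace Y] {ξ : Y → ℝ}
    (hξ : ξ ∈ BddMeas Set.univ Y) {ε : ℝ} (hε : 0 < ε) :
    ∃ f : SimpleFunc Y ℝ, (∀ y, f y ≤ ξ y) ∧ ∀ y, ξ y ≤ f y + ε := by
  obtain ⟨hm, ⟨M, hM⟩, -⟩ := hξ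
  have hfl : Measurable fun y => ⌊ξ y / ε⌋ := Int.measurable_floor.comp (hm.div_const ε)
  have hfin : (Set.range fun y => ⌊ξ y / ε⌋).Finite := by
    refine (Set.finite_Icc ⌊-M / ε⌋ ⌊M / ε⌋).subset ?_
    rintro _ ⟨y, rfl⟩
    have h := abs_le.1 (hM y)
    exact ⟨Int.floor_mono (by gcongr; exact h.1), Int.floor_mono (by gcongr; exact h.2)⟩
  let k : SimpleFunc Y ℤ :=
    ⟨fun y => ⌊ξ y / ε⌋, fun n => hfl (measurableSet_singleton n), hfin⟩
  refine ⟨k.map fun n : ℤ => (n : ℝ) * ε, fun y => ?_, fun y => ?_⟩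
  · exact (le_div_iff₀ hε).1 (Int.floor_le (ξ y / ε))
  · have h := (div_le_iff₀ hε).1 (Int.lt_floor_add_one (ξ y / ε)).le
    rw [add_mul, one_mul] at h
    exact h

/-! ### Measurability in `p`, barycenters and finite mixtures. -/

namespace FinAddProb

variable {Y Z : Type*} [MeasurableSpace Y] [MeasurableSpace Z]

theorem abs_integral_le (p : FinAddProb Y) {ξ : Y → ℝ} (hξ : ξ ∈ BddMeas Set.univ Y) {M : ℝ}
    (hM : ∀ y, |ξ y| ≤ M) : |p.integral ξ| ≤ M := by
  refine abs_le.2 ⟨?_, ?_⟩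
  · have h := p.integral_mem_Icc (ξ := ξ) (f := SimpleFunc.const Y (-M)) (ε := 2 * M)
      (fun y => (abs_le.1 (hM y)).1)
      (fun y => by simpa using (by linarith [(abs_le.1 (hM y)).2] : ξ y ≤ -M + 2 * M))
    rw [simpleIntegral_const] at h
    exact h.1
  · refine le_of_forall_pos_le_add fun ε hε => ?_
    obtain ⟨f, hf, hf'⟩ := exists_simpleFunc_approx hξ hε
    have hle : p.simpleIntegral f ≤ M := by
      rw [← p.simpleIntegral_const M]
      exact p.simpleIntegral_mono fun y => (hf y).trans (abs_le.1 (hM y)).2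
    linarith [(p.integral_mem_Icc hf hf').2]

theorem measurable_integral {ξ : Y → ℝ} (hξ : ξ ∈ BddMeas Set.univ Y) :
    Measurable fun p : FinAddProb Y => p.integral ξ := by
  have h : Continuous fun (p : FinAddProb Y) (ξ : BddMeas Set.univ Y) => p.integral ξ.1 :=
    continuous_induced_dom
  exact ((continuous_apply (⟨ξ, hξ⟩ : BddMeas Set.univ Y)).comp h).measurable

theorem measurable_prob {A : Set Y} (hA : MeasurableSet A) :
    Measurable fun p : FinAddProb Y => p.prob A := by
  let f := SimpleFunc.piecewise A hA (SimpleFunc.const Y (1 : ℝ)) (SimpleFunc.const Y 0)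
  have hf : ⇑f ∈ BddMeas Set.univ Y := by
    refine ⟨f.measurable, ⟨1, fun y => ?_⟩, fun _ => trivial⟩
    by_cases hy : y ∈ A <;> simp [f, hy]
  have h : (fun p : FinAddProb Y => p.prob A) = fun p => p.integral f :=
    funext fun p => ((p.integral_simpleFunc f).trans (p.simpleIntegral_indicator hA)).symm
  rw [h]
  exact measurable_integral hf

theorem integrable_prob (ν : Measure (FinAddProb Y)) [IsFiniteMeasure ν] {A : Set Y}
    (hA : MeasurableSet A) : Integrable (fun p : FinAddProb Y => p.prob A) ν :=
  .of_bound (measurable_prob hA).aestronglyMeasurable 1 <| .of_forall fun p => by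
    rw [Real.norm_eq_abs, abs_of_nonneg (p.nonneg A hA)]
    exact p.prob_le_one hA

theorem integrable_integral (ν : Measure (FinAddProb Y)) [IsFiniteMeasure ν] {ξ : Y → ℝ}
    (hξ : ξ ∈ BddMeas Set.univ Y) : Integrable (fun p : FinAddProb Y => p.integral ξ) ν := by
  obtain ⟨M, hM⟩ := hξ.2.1
  exact .of_bound (measurable_integral hξ).aestronglyMeasurable M <|
    .of_forall fun p => p.abs_integral_le hξ hM

open Classical in
/-- The barycenter of a countably additive probability on `Δ(Y)`. -/
noncomputable def barycenter (ν : Measure (FinAddProb Y)) [IsProbabilityMeasure ν] :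
    FinAddProb Y where
  prob A := if MeasurableSet A then ∫ Q, Q.prob A ∂ν else 0
  nonneg A hA := by
    rw [if_pos hA]
    exact integral_nonneg fun Q => Q.nonneg A hA
  univ := by simp [FinAddProb.univ]
  union A B hA hB hd := by
    rw [if_pos hA, if_pos hB, if_pos (hA.union hB),
      ← integral_add (integrable_prob ν hA) (integrable_prob ν hB)]
    exact integral_congr_ae (.of_forall fun Q => Q.union A B hA hB hd)
  not_meas A hA := if_neg hA

/-- Finite linearity carries the identity from events to simple functions, and uniform approximation
carries it to `ξ`; no convergence theorem for `P` is needed. -/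
theorem integral_eq_of_prob_eq {P : FinAddProb Y} {ν : Measure (FinAddProb Y)}
    [IsProbabilityMeasure ν] (hP : ∀ A, MeasurableSet A → P.prob A = ∫ Q, Q.prob A ∂ν)
    {ξ : Y → ℝ} (hξ : ξ ∈ BddMeas Set.univ Y) :
    P.integral ξ = ∫ Q, Q.integral ξ ∂ν := by
  refine eq_of_forall_dist_le fun ε hε => ?_
  obtain ⟨f, hf, hf'⟩ := exists_simpleFunc_approx hξ hε
  have hint (x : ℝ) (_ : x ∈ f.range) :
      Integrable (fun Q : FinAddProb Y => x * Q.prob (f ⁻¹' {x})) ν :=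
    (integrable_prob ν (f.measurableSet_fiber x)).const_mul x
  have hintf : Integrable (fun Q : FinAddProb Y => Q.simpleIntegral f) ν :=
    integrable_finsetSum _ hint
  have hPf : P.simpleIntegral f = ∫ Q, Q.simpleIntegral f ∂ν := by
    simp only [simpleIntegral]
    rw [integral_finsetSum _ hint]
    exact Finset.sum_congr rfl fun x _ => by
      rw [hP _ (f.measurableSet_fiber x), integral_const_mul]
  have h1 := P.integral_mem_Icc hf hf'
  have h2 : ∫ Q, Q.simpleIntegral f ∂ν ≤ ∫ Q, Q.integral ξ ∂ν :=
    integral_mono hintf (integrable_integral ν hξ) fun Q => (Q.integral_mem_Icc hf hf').1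
  have h3 : ∫ Q, Q.integral ξ ∂ν ≤ ∫ Q, Q.simpleIntegral f ∂ν + ε := by
    have : ∫ Q, Q.integral ξ ∂ν ≤ ∫ Q, (Q.simpleIntegral f + ε) ∂ν :=
      integral_mono (integrable_integral ν hξ) (hintf.add (integrable_const ε))
        fun Q => (Q.integral_mem_Icc hf hf').2
    rwa [integral_add hintf (integrable_const ε), integral_const, probReal_univ, one_smul] at this
  rw [Real.dist_eq, abs_le]
  constructor <;> linarith [h1.1, h1.2]

/-- Integrating against a finite mixture of image measures. -/
theorem integral_eq_sum_of_prob_eq {ι : Type*} [Fintype ι] {P : FinAddProb Y} {w : ι → ℝ}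
    {Q : ι → FinAddProb Z} {g : ι → Z → Y} (hw : ∀ i, 0 ≤ w i) (hg : ∀ i, Measurable (g i))
    (hP : ∀ A, MeasurableSet A → P.prob A = ∑ i, w i * (Q i).prob (g i ⁻¹' A))
    {ξ : Y → ℝ} (hξ : ξ ∈ BddMeas Set.univ Y) :
    P.integral ξ = ∑ i, w i * (Q i).integral (ξ ∘ g i) := by
  -- Total mass one, read off from the whole space, keeps the averaged error equal to `ε`.
  have hw1 : ∑ i, w i = 1 := by
    simpa [FinAddProb.univ] using (hP Set.univ .univ).symm
  refine eq_of_forall_dist_le fun ε hε => ?_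
  obtain ⟨f, hf, hf'⟩ := exists_simpleFunc_approx hξ hε
  have hPf : P.simpleIntegral f = ∑ i, w i * (Q i).simpleIntegral (f.comp (g i) (hg i)) := by
    simp only [simpleIntegral_comp, Finset.mul_sum]
    rw [Finset.sum_comm, simpleIntegral]
    refine Finset.sum_congr rfl fun x _ => ?_
    rw [hP _ (f.measurableSet_fiber x), Finset.mul_sum]
    exact Finset.sum_congr rfl fun i _ => by ring
  have hQ (i : ι) := (Q i).integral_mem_Icc (ξ := ξ ∘ g i) (f := f.comp (g i) (hg i)) (ε := ε)
    (fun y => hf (g i y)) (fun y => hf' (g i y))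
  have h1 := P.integral_mem_Icc hf hf'
  have h2 : P.simpleIntegral f ≤ ∑ i, w i * (Q i).integral (ξ ∘ g i) := by
    rw [hPf]
    exact Finset.sum_le_sum fun i _ => mul_le_mul_of_nonneg_left (hQ i).1 (hw i)
  have h3 : ∑ i, w i * (Q i).integral (ξ ∘ g i) ≤ P.simpleIntegral f + ε := by
    calc ∑ i, w i * (Q i).integral (ξ ∘ g i)
        ≤ ∑ i, w i * ((Q i).simpleIntegral (f.comp (g i) (hg i)) + ε) :=
          Finset.sum_le_sum fun i _ => mul_le_mul_of_nonneg_left (hQ i).2 (hw i)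
      _ = P.simpleIntegral f + ε := by
          simp only [mul_add, Finset.sum_add_distrib, ← Finset.sum_mul, hw1, one_mul, hPf]
  rw [Real.dist_eq, abs_le]
  constructor <;> linarith [h1.1, h1.2]

theorem prob_eq_sum_singleton {S : Type*} [Fintype S] [MeasurableSpace S]
    [MeasurableSingletonClass S] (p : FinAddProb S) (A : Set S) :
    p.prob A = ∑ s, p.prob {s} * A.indicator 1 s := by
  rw [p.prob_eq_sum_fiber id (fun s => measurableSet_singleton s) A.toFinite.measurableSet]
  refine Finset.sum_congr rfl fun s _ => ?_
  by_cases hs : s ∈ A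
  · simp [hs]
  · simp [hs, p.prob_empty]

theorem ext_singleton {S : Type*} [Fintype S] [MeasurableSpace S]
    [MeasurableSingletonClass S] {p q : FinAddProb S} (h : ∀ s, p.prob {s} = q.prob {s}) :
    p = q :=
  ext_of_measurableSet fun A _ => by
    rw [p.prob_eq_sum_singleton, q.prob_eq_sum_singleton]
    simp only [h]

theorem integral_const (p : FinAddProb Y) (c : ℝ) : p.integral (fun _ => c) = c :=
  (p.integral_simpleFunc (SimpleFunc.const Y c)).trans (p.simpleIntegral_const c)

theorem integral_eq_sum_singleton {S : Type*} [Fintype S] [MeasurableSpace S]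
    [MeasurableSingletonClass S] (p : FinAddProb S) (g : S → ℝ) :
    p.integral g = ∑ s, p.prob {s} * g s := by
  -- `p` is a mixture of point masses, each the image of an arbitrary probability (here `p`) under a
  -- constant map.
  have h := integral_eq_sum_of_prob_eq (P := p) (w := fun s => p.prob {s}) (Q := fun _ => p)
    (g := fun s _ => s) (fun s => p.prob_nonneg _) (fun s => measurable_const)
    (fun A _ => by
      rw [p.prob_eq_sum_singleton A]
      refine Finset.sum_congr rfl fun s _ => ?_
      by_cases hs : s ∈ A
      · simp [hs, p.univ]
      · simp [hs, p.prob_empty])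
    (mem_bddMeas_of_finite g)
  simpa only [Function.comp_def, integral_const] using h

theorem integral_const_mul (p : FinAddProb Y) {ξ : Y → ℝ} (hξ : ξ ∈ BddMeas Set.univ Y)
    {c : ℝ} (hc : 0 < c) : p.integral (fun y => c * ξ y) = c * p.integral ξ := by
  refine eq_of_forall_dist_le fun ε hε => ?_
  obtain ⟨f, hf, hf'⟩ := exists_simpleFunc_approx hξ (div_pos hε hc)
  have h1 := p.integral_mem_Icc hf hf'
  have h2 := p.integral_mem_Icc (ξ := fun y => c * ξ y) (f := c • f) (ε := ε)
    (fun y => mul_le_mul_of_nonneg_left (hf y) hc.le)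
    (fun y => (mul_le_mul_of_nonneg_left (hf' y) hc.le).trans_eq
      (by rw [mul_add, mul_div_cancel₀ _ hc.ne']; rfl))
  have h3 : p.simpleIntegral (c • f) = c * p.simpleIntegral f := by
    simp only [simpleIntegral_eq_setToSimpleFunc]
    exact SimpleFunc.setToSimpleFunc_smul_real _ p.finMeasAdditive_weightedId c
      integrable_zero_measure
  have h4 := mul_le_mul_of_nonneg_left h1.1 hc.le
  have h5 := mul_le_mul_of_nonneg_left h1.2 hc.le
  rw [mul_add, mul_div_cancel₀ _ hc.ne'] at h5
  rw [h3] at h2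
  rw [Real.dist_eq, abs_le]
  constructor <;> linarith [h2.1, h2.2]

end FinAddProb

/-! ### Splitting and composing laws on histories. -/

section Histories

variable {S : Type*} [MeasurableSpace S]

theorem measurable_prepend (s : S) : Measurable (prepend s) := by
  refine measurable_pi_lambda _ fun n => ?_
  cases n with
  | zero => exact measurable_const
  | succ n => exact measurable_pi_apply n

theorem continuation_mem_bddMeas {ξ : (ℕ → S) → ℝ}
    (hξ : ξ ∈ BddMeas Set.univ (ℕ → S)) (s : S) :
    continuation ξ s ∈ BddMeas Set.univ (ℕ → S) :=
  BddMeas.comp hξ (measurable_prepend s)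

variable [MeasurableSingletonClass S]

namespace FinAddProb

theorem marginal_prob_singleton (P : FinAddProb (ℕ → S)) (s : S) :
    P.marginal.prob {s} = P.prob {ω | ω 0 = s} := by
  simp only [marginal, map, measurableSet_singleton, if_true]
  rfl

variable [Fintype S]

theorem prob_eq_sum_conditional (P : FinAddProb (ℕ → S)) {A : Set (ℕ → S)}
    (hA : MeasurableSet A) :
    P.prob A = ∑ s, P.marginal.prob {s} * (P.conditional s).prob (prepend s ⁻¹' A) := by
  rw [P.prob_eq_sum_fiber (fun ω => ω 0) measurableSet_head hA]
  refine Finset.sum_congr rfl fun s _ => ?_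
  have hs : MeasurableSet ((fun ω : ℕ → S => ω 0) ⁻¹' {s} ∩ A) := (measurableSet_head s).inter hA
  rw [marginal_prob_singleton]
  by_cases h : P.prob {ω | ω 0 = s} = 0
  · rw [h, zero_mul]
    refine le_antisymm ?_ (P.prob_nonneg _)
    rw [← h]
    exact P.prob_mono hs (measurableSet_head s) Set.inter_subset_left
  · simp only [conditional, h, dite_false, measurable_prepend s hA, if_true]
    rw [mul_div_cancel₀ _ h]
    congr 1
    ext ω
    simp only [Set.mem_inter_iff, Set.mem_preimage, Set.mem_singleton_iff, Set.mem_ofPred_eq]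
    refine and_congr_right fun h0 => ?_
    have : prepend s (fun n => ω (n + 1)) = ω := by
      funext n
      cases n with
      | zero => exact h0.symm
      | succ n => rfl
    rw [this]

open Classical in
/-- The finitely additive probability on histories with first-period law `p` and continuation
laws `Q s`. -/
noncomputable def compose (p : FinAddProb S) (Q : S → FinAddProb (ℕ → S)) :
    FinAddProb (ℕ → S) where
  prob A := if MeasurableSet A then ∑ s, p.prob {s} * (Q s).prob (prepend s ⁻¹' A) else 0
  nonneg A hA := by
    rw [if_pos hA]
    exact Finset.sum_nonneg fun s _ => mul_nonneg (p.prob_nonneg _) ((Q s).prob_nonneg _)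
  univ := by
    have h := p.prob_eq_sum_singleton Set.univ
    simp only [Set.indicator_univ, Pi.one_apply, mul_one, p.univ] at h
    simp [FinAddProb.univ, ← h]
  union A B hA hB hd := by
    rw [if_pos hA, if_pos hB, if_pos (hA.union hB), ← Finset.sum_add_distrib]
    refine Finset.sum_congr rfl fun s _ => ?_
    rw [Set.preimage_union, (Q s).union _ _ (measurable_prepend s hA) (measurable_prepend s hB)
      (hd.preimage _), mul_add]
  not_meas A hA := if_neg hA

theorem compose_prob_head_inter (p : FinAddProb S) (Q : S → FinAddProb (ℕ → S)) (s : S)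
    {A : Set (ℕ → S)} (hA : MeasurableSet A) :
    (compose p Q).prob ({ω | ω 0 = s} ∩ (fun ω n => ω (n + 1)) ⁻¹' A) =
      p.prob {s} * (Q s).prob A := by
  classical
  have hm := (measurableSet_head s).inter (measurable_shift hA)
  simp only [compose, hm, if_true]
  rw [Finset.sum_eq_single s]
  · congr 2
    ext ω
    simp [prepend]
  · intro t _ hts
    have : prepend t ⁻¹' ({ω | ω 0 = s} ∩ (fun ω n => ω (n + 1)) ⁻¹' A) = ∅ := by
      ext ω
      simp [prepend, hts]
    rw [this, prob_empty, mul_zero]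
  · simp

theorem marginal_compose (p : FinAddProb S) (Q : S → FinAddProb (ℕ → S)) :
    (compose p Q).marginal = p := by
  refine ext_singleton fun s => ?_
  have h := compose_prob_head_inter p Q s .univ
  rwa [Set.preimage_univ, Set.inter_univ, (Q s).univ, mul_one, ← marginal_prob_singleton] at h

/-- With `marginal_compose`, this makes the marginal and the conditionals free, independent choices;
at null `s` the conditional is only a placeholder. -/
theorem conditional_compose (p : FinAddProb S) (Q : S → FinAddProb (ℕ → S)) {s : S}
    (hs : p.prob {s} ≠ 0) : (compose p Q).conditional s = Q s := by
  have h : (compose p Q).prob {ω | ω 0 = s} = p.prob {s} := by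
    rw [← marginal_prob_singleton, marginal_compose]
  refine ext_of_measurableSet fun A hA => ?_
  simp only [conditional, h, hs, dite_false, hA, if_true]
  rw [compose_prob_head_inter p Q s hA, mul_div_cancel_left₀ _ hs]

/-- The law of iterated expectations. -/
theorem integral_eq_sum_conditional (P : FinAddProb (ℕ → S)) {ξ : (ℕ → S) → ℝ}
    (hξ : ξ ∈ BddMeas Set.univ (ℕ → S)) :
    P.integral ξ =
      ∑ s, P.marginal.prob {s} * (P.conditional s).integral (continuation ξ s) :=
  integral_eq_sum_of_prob_eq (fun _ => prob_nonneg _ _) measurable_prepend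
    (fun _ hA => P.prob_eq_sum_conditional hA) hξ

end FinAddProb

end Histories

/-! ### The Gibbs variational principle. -/

section DonskerVaradhan

open InformationTheory

variable {α : Type*} [MeasurableSpace α] {μ ν : Measure α} [IsProbabilityMeasure μ]

/-- This is nonnegativity of the entropy of `ν` relative to the tilted measure proportional to
`exp(-F) μ`, with the log-likelihood ratio expanded. -/
theorem neg_log_integral_exp_neg_le [IsProbabilityMeasure ν] {F : α → ℝ} (hF : Measurable F)
    {M : ℝ} (hM : ∀ x, |F x| ≤ M) (hkl : klDiv ν μ ≠ ⊤) :
    -Real.log (∫ x, Real.exp (-F x) ∂μ) ≤ ∫ x, F x ∂ν + (klDiv ν μ).toReal := by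
  obtain ⟨hac, hint⟩ := klDiv_ne_top_iff.1 hkl
  have hexp : Integrable (fun x => Real.exp (-F x)) μ :=
    .of_bound hF.neg.exp.aestronglyMeasurable (Real.exp M) <| .of_forall fun x => by
      rw [Real.norm_eq_abs, Real.abs_exp]
      exact Real.exp_le_exp.2 (by linarith [(abs_le.1 (hM x)).1])
  have hFν : Integrable (fun x => -F x) ν :=
    .of_bound hF.neg.aestronglyMeasurable M <| .of_forall fun x => by simpa using hM x
  have := isProbabilityMeasure_tilted hexp
  have hac' : ν ≪ μ.tilted fun x => -F x := hac.trans (absolutelyContinuous_tilted hexp)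
  have hpos := integral_llr_add_sub_measure_univ_nonneg hac'
    (integrable_llr_tilted_right hac hFν hint hexp)
  rw [integral_llr_tilted_right hac hFν hexp hint, integral_neg] at hpos
  rw [toReal_klDiv_of_measure_eq hac (by simp)]
  simp only [probReal_univ] at hpos
  linarith

/-- The tilted measure itself attains equality: its log-density `-F - log ∫ exp(-F) dμ` is bounded,
so its entropy is finite and explicit. -/
theorem exists_neg_log_integral_exp_neg_eq {F : α → ℝ} (hF : Measurable F)
    {M : ℝ} (hM : ∀ x, |F x| ≤ M) :
    ∃ ν : Measure α, IsProbabilityMeasure ν ∧ ν ≪ μ ∧ klDiv ν μ ≠ ⊤ ∧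
      -Real.log (∫ x, Real.exp (-F x) ∂μ) = ∫ x, F x ∂ν + (klDiv ν μ).toReal := by
  have hexp : Integrable (fun x => Real.exp (-F x)) μ :=
    .of_bound hF.neg.exp.aestronglyMeasurable (Real.exp M) <| .of_forall fun x => by
      rw [Real.norm_eq_abs, Real.abs_exp]
      exact Real.exp_le_exp.2 (by linarith [(abs_le.1 (hM x)).1])
  have hprob := isProbabilityMeasure_tilted hexp
  have hac : (μ.tilted fun x => -F x) ≪ μ := tilted_absolutelyContinuous μ _
  have hFν : Integrable F (μ.tilted fun x => -F x) :=
    .of_bound hF.aestronglyMeasurable M <| .of_forall hM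
  have hllr : llr (μ.tilted fun x => -F x) μ =ᵐ[μ.tilted fun x => -F x]
      fun x => -F x - Real.log (∫ x, Real.exp (-F x) ∂μ) :=
    hac.ae_le (log_rnDeriv_tilted_left_self hexp)
  have hint : Integrable (llr (μ.tilted fun x => -F x) μ) (μ.tilted fun x => -F x) :=
    (integrable_congr hllr).2 (hFν.neg.sub (integrable_const _))
  refine ⟨_, hprob, hac, klDiv_ne_top hac hint, ?_⟩
  rw [toReal_klDiv_of_measure_eq hac (by simp), integral_congr_ae hllr,
    integral_sub (f := fun x => -F x) hFν.neg (integrable_const _), integral_neg, integral_const, probReal_univ,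
    one_smul]
  ring

end DonskerVaradhan

/-- The certainty equivalent `-log ∫ exp(-∫ ξ dp) dμ(p)`. -/
noncomputable def entropicCE {Y : Type*} [MeasurableSpace Y] (μ : Measure (FinAddProb Y))
    (ξ : Y → ℝ) : ℝ :=
  -Real.log (∫ p, Real.exp (-p.integral ξ) ∂μ)

/-! ### The certainty equivalent as a minimum over barycenters. -/

section Variational

variable {Y : Type*} [MeasurableSpace Y] {μ : Measure (FinAddProb Y)} [IsProbabilityMeasure μ]
  {ξ : Y → ℝ}

/-- All `ν ∈ Γ(P, μ)` give the same linear term `∫ ξ dP`, so the Gibbs bound passes to the infimum.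
The `ENNReal` form also covers infinite entropy and empty `Γ(P, μ)`. -/
theorem ofReal_entropicCE_sub_le_minEntropy (hξ : ξ ∈ BddMeas Set.univ Y) (P : FinAddProb Y) :
    ENNReal.ofReal (entropicCE μ ξ - P.integral ξ) ≤ minEntropy μ P := by
  refine le_iInf₂ fun ν ⟨hprob, _, hbary⟩ => ?_
  by_cases hkl : InformationTheory.klDiv ν μ = ⊤
  · simp [hkl]
  obtain ⟨M, hM⟩ := hξ.2.1
  have h := neg_log_integral_exp_neg_le (FinAddProb.measurable_integral hξ)
    (fun p => p.abs_integral_le hξ hM) hkl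
  rw [FinAddProb.integral_eq_of_prob_eq hbary hξ]
  exact ENNReal.ofReal_le_of_le_toReal (by rw [entropicCE]; linarith)

theorem entropicCE_le (hξ : ξ ∈ BddMeas Set.univ Y) {P : FinAddProb Y}
    (hP : minEntropy μ P ≠ ⊤) :
    entropicCE μ ξ ≤ P.integral ξ + (minEntropy μ P).toReal := by
  have h := (ENNReal.ofReal_le_iff_le_toReal hP).1
    (ofReal_entropicCE_sub_le_minEntropy (μ := μ) hξ P)
  linarith

/-- The minimizer is the barycenter of the tilted measure, whose entropy bounds `minEntropy` from
above; `entropicCE_le` is the reverse bound. No compactness is used. -/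
theorem exists_entropicCE_eq (hξ : ξ ∈ BddMeas Set.univ Y) :
    ∃ P : FinAddProb Y, minEntropy μ P ≠ ⊤ ∧
      entropicCE μ ξ = P.integral ξ + (minEntropy μ P).toReal := by
  obtain ⟨M, hM⟩ := hξ.2.1
  obtain ⟨ν, hprob, hac, hkl, heq⟩ := exists_neg_log_integral_exp_neg_eq (μ := μ)
    (FinAddProb.measurable_integral hξ) (fun p => p.abs_integral_le hξ hM)
  have hbary (A : Set Y) (hA : MeasurableSet A) :
      (FinAddProb.barycenter ν).prob A = ∫ Q, Q.prob A ∂ν := if_pos hA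
  have hle : minEntropy μ (FinAddProb.barycenter ν) ≤ InformationTheory.klDiv ν μ :=
    iInf₂_le ν ⟨hprob, hac, hbary⟩
  have htop := ne_top_of_le_ne_top hkl hle
  refine ⟨FinAddProb.barycenter ν, htop, (entropicCE_le hξ htop).antisymm ?_⟩
  rw [entropicCE, heq, FinAddProb.integral_eq_of_prob_eq hbary hξ]
  gcongr

theorem smoothCE_eq_entropicCE (hξ : ξ ∈ BddMeas Set.univ Y) {θ : ℝ} (hθ : 0 < θ) :
    smoothCE (fun x => -Real.exp (-θ * x)) μ ξ = entropicCE μ (fun y => θ * ξ y) / θ := by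
  have hinj : Function.Injective fun x : ℝ => -Real.exp (-θ * x) := fun x y h => by
    have := Real.exp_injective (neg_injective h)
    exact mul_left_cancel₀ (neg_ne_zero.2 hθ.ne') this
  have hbdd := BddMeas.const_mul hξ θ
  have hexp : Integrable (fun p : FinAddProb Y => Real.exp (-p.integral fun y => θ * ξ y)) μ := by
    obtain ⟨M, hM⟩ := hbdd.2.1
    refine .of_bound (FinAddProb.measurable_integral hbdd).neg.exp.aestronglyMeasurable
      (Real.exp M) <| .of_forall fun p => ?_
    rw [Real.norm_eq_abs, Real.abs_exp]
    exact Real.exp_le_exp.2 (by linarith [(abs_le.1 (p.abs_integral_le hbdd hM)).1])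
  -- The integral of `φ` is strictly negative, hence in the range of `φ`, where `Function.invFun` is
  -- the true inverse.
  have hval : (fun x : ℝ => -Real.exp (-θ * x)) (entropicCE μ (fun y => θ * ξ y) / θ) =
      ∫ p, -Real.exp (-θ * p.integral ξ) ∂μ := by
    have h1 : -θ * (entropicCE μ (fun y => θ * ξ y) / θ) =
        Real.log (∫ p, Real.exp (-p.integral fun y => θ * ξ y) ∂μ) := by
      rw [entropicCE]
      field_simp
    simp only [h1]
    rw [Real.exp_log (integral_exp_pos hexp), integral_neg]
    simp only [FinAddProb.integral_const_mul _ hξ hθ, neg_mul]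
  rw [smoothCE, ← hval]
  exact Function.leftInverse_invFun hinj _

end Variational

/-! ### Dynamic programming from the no-gain identity. -/

section Recursion

variable {S : Type*} [Fintype S] [MeasurableSpace S] [MeasurableSingletonClass S]
  {μ₀ : Measure (FinAddProb (ℕ → S))} [IsProbabilityMeasure μ₀]
  {μ₁ : Measure (FinAddProb S)} [IsProbabilityMeasure μ₁] {ξ : (ℕ → S) → ℝ}

theorem EntropicNoGain.entropicCE_recursion (hgain : EntropicNoGain μ₀ μ₁)
    (hξ : ξ ∈ BddMeas Set.univ (ℕ → S)) :
    entropicCE μ₀ ξ = entropicCE μ₁ fun s => entropicCE μ₀ (continuation ξ s) := by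
  have hcont := continuation_mem_bddMeas hξ
  have hv := mem_bddMeas_of_finite fun s => entropicCE μ₀ (continuation ξ s)
  -- Finite entropy of `P` forces finite entropy of its marginal and non-null conditionals, so the
  -- objective splits in real numbers.
  have key (P : FinAddProb (ℕ → S)) (hP : minEntropy μ₀ P ≠ ⊤) :
      minEntropy μ₁ P.marginal ≠ ⊤ ∧
      (∀ s, P.marginal.prob {s} ≠ 0 → minEntropy μ₀ (P.conditional s) ≠ ⊤) ∧
      P.integral ξ + (minEntropy μ₀ P).toReal =
        ∑ s, P.marginal.prob {s} * ((P.conditional s).integral (continuation ξ s) +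
          (minEntropy μ₀ (P.conditional s)).toReal) + (minEntropy μ₁ P.marginal).toReal := by
    rw [hgain P, ENNReal.add_ne_top, ENNReal.sum_ne_top] at hP
    refine ⟨hP.2, fun s hs htop => hP.1 s (Finset.mem_univ s) ?_, ?_⟩
    · rw [htop, ENNReal.mul_top]
      exact (ENNReal.ofReal_pos.2 (lt_of_le_of_ne (FinAddProb.prob_nonneg _ _) hs.symm)).ne'
    · rw [hgain P, ENNReal.toReal_add (ENNReal.sum_ne_top.2 hP.1) hP.2,
        ENNReal.toReal_sum hP.1, P.integral_eq_sum_conditional hξ, ← add_assoc,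
        ← Finset.sum_add_distrib]
      simp only [ENNReal.toReal_mul, ENNReal.toReal_ofReal (FinAddProb.prob_nonneg _ _), mul_add]
  refine le_antisymm ?_ ?_
  -- Composing an optimal marginal with optimal continuation laws gives a candidate for the global
  -- problem.
  · obtain ⟨p, hp, hpeq⟩ := exists_entropicCE_eq (μ := μ₁) hv
    choose Q hQ hQeq using fun s => exists_entropicCE_eq (μ := μ₀) (hcont s)
    have hcond (s : S) (hs : p.prob {s} ≠ 0) := FinAddProb.conditional_compose p Q hs
    have htop : minEntropy μ₀ (FinAddProb.compose p Q) ≠ ⊤ := by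
      rw [hgain, FinAddProb.marginal_compose, ENNReal.add_ne_top, ENNReal.sum_ne_top]
      refine ⟨fun s _ => ?_, hp⟩
      by_cases hs : p.prob {s} = 0
      · simp [hs]
      · rw [hcond s hs]
        exact ENNReal.mul_ne_top ENNReal.ofReal_ne_top (hQ s)
    refine (entropicCE_le hξ htop).trans_eq ?_
    rw [(key _ htop).2.2, FinAddProb.marginal_compose, hpeq, p.integral_eq_sum_singleton]
    congr 1
    refine Finset.sum_congr rfl fun s _ => ?_
    by_cases hs : p.prob {s} = 0
    · simp [hs]
    · rw [hcond s hs, hQeq s]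
  -- Conversely, the marginal and conditionals of a global optimum are candidates for the one-step
  -- and continuation problems.
  · obtain ⟨P, hP, hPeq⟩ := exists_entropicCE_eq (μ := μ₀) hξ
    obtain ⟨h1, h2, h3⟩ := key P hP
    refine (entropicCE_le hv h1).trans ?_
    rw [hPeq, h3, FinAddProb.integral_eq_sum_singleton]
    refine add_le_add_left (Finset.sum_le_sum fun s _ => ?_) _
    by_cases hs : P.marginal.prob {s} = 0
    · simp [hs]
    · exact mul_le_mul_of_nonneg_left (entropicCE_le (hcont s) (h2 s hs))
        (FinAddProb.prob_nonneg _ _)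

end Recursion

end GenRect

/-! ### Back to the smooth ambiguity functionals. -/

open GenRect
theorem corollary6
    {S : Type*} [Fintype S] [MeasurableSpace S] [MeasurableSingletonClass S]
    (hS : 3 ≤ Fintype.card S)
    {C : Type*} [TopologicalSpace C] [CompactSpace C] [TopologicalSpace.MetrizableSpace C]
    [MeasurableSpace C] [BorelSpace C] [Nontrivial C]
    (u : ProbabilityMeasure C → ℝ) (hu_cont : Continuous u) (hu_aff : AffineOnLotteries u)
    (hu_nonconst : ∃ x y, u x ≠ u y)
    (β : ℝ) (hβ0 : 0 < β) (hβ1 : β < 1)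
    (θ : ℝ) (hθ : 0 < θ)
    (μ₀ : Measure (FinAddProb (ℕ → S))) [IsProbabilityMeasure μ₀]
    (μ₁ : Measure (FinAddProb S)) [IsProbabilityMeasure μ₁]
    (hgain : EntropicNoGain μ₀ μ₁) :
    GeneralizedRectangularity (discountedRange u β) β
      (smoothCE (fun x => -Real.exp (-θ * x)) μ₀)
      (smoothCE (fun x => -Real.exp (-θ * β * x)) μ₁) := by
  intro ξ hξ
  have hξ' : ξ ∈ BddMeas Set.univ (ℕ → S) := ⟨hξ.1, hξ.2.1, fun _ => trivial⟩
  have hθβ : 0 < θ * β := mul_pos hθ hβ0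
  have h1 := smoothCE_eq_entropicCE (μ := μ₁)
    (mem_bddMeas_of_finite fun s => 1 / β *
      smoothCE (fun x => -Real.exp (-θ * x)) μ₀ (continuation ξ s)) hθβ
  simp only [neg_mul] at h1 ⊢
  rw [h1]
  have h0 {η : (ℕ → S) → ℝ} (hη : η ∈ BddMeas Set.univ (ℕ → S)) :=
    smoothCE_eq_entropicCE (μ := μ₀) hη hθ
  simp only [neg_mul] at h0
  rw [h0 hξ', hgain.entropicCE_recursion (BddMeas.const_mul hξ' θ)]
  -- The `β` of the one-step parameter `θβ` cancels the inner `1 / β`, leaving `θ` times the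
  -- continuation value.
  have hs : (fun s => θ * β * (1 / β * smoothCE (fun x => -Real.exp (-(θ * x))) μ₀
      (continuation ξ s))) =
      fun s => entropicCE μ₀ (continuation (fun ω => θ * ξ ω) s) := by
    funext s
    rw [h0 (continuation_mem_bddMeas hξ' s)]
    field_simp
    rfl
  rw [hs]
  field_simp
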